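/- Write $[n]=\{1,\dots,n\}$. Let $\widehat{\mathbf{WQSym}}$ be the space of formal (possibly infinite) $\mathbb{Q}$-linear combinations of surjections $f:[n]\to[p]$ ($n\ge 0$; for $n=0$ there is one surjection, the empty one, denoted $1$), equipped with the quasi-shuffle product: for surjections $f$ of $[n]$ and $g$ of $[m]$, $f\star g$ is the sum of all surjections $h$ of $[n+m]$ such that the words $h(1)\dots h(n)$ and $h(n+1)\dots h(n+m)$ have packings $f$ and $g$ (packing relabels the letters by $1,2,\dots$ in an order-preserving way). The unit is $1$. Let $\mathrm{Id}=\sum_{n\ge0}\mathrm{id}_{[n]}$. For a surjection $f:[n]\to[p]$ let $\mathrm{Des}(f)=\{i<n: f(i)>f(i+1)\}$ and let $\tilde f:[n]\to[p]$ be the conjugate surjection $\tilde f(i)=f(n+1-i)$. Then $$\log^{\star}(\mathrm{Id})=\sum_{n\ge 1}\frac1n\sum_{I\models n}\frac{(-1)^{l(I)-1}}{\binom{n-1}{l(I)-1}}\sum_{\mathrm{Des}(f)=[n]-\{i_{l(I)},\,i_{l(I)}+i_{l(I)-1},\,\dots,\,i_{l(I)}+\cdots+i_1\}}\tilde f ,$$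 where $I\models n$ means that $I=(i_1,\dots,i_{l(I)})$ is a composition of $n$, the innermost sum runs over the surjections $f$ with domain $[n]$, and $\log^\star(x)=\sum_{k\ge1}\frac{(-1)^{k-1}}{k}(x-1)^{\star k}$ converges formally (in each degree $n$ the partial sums are eventually constant). Moreover the same formula computes the logarithm of the identity map on quasi-shuffle algebras. Let $A$ be a commutative, not necessarily unital, $\mathbb{Q}$-algebra, and let $T(A)$ be its tensor algebra, with the deconcatenation coproduct and with the quasi-shuffle product, which is the bilinear product whose unit is the empty word and which satisfies $$au\star bv=a(u\star bv)+b(au\star v)+(a\cdot b)(u\star v)$$ for letters $a,b\in A$ and words $u,v$. Let a surjection $f:[n]\to[p]$ act on words of length $n$ by $f(a_1\dots a_n)=b_1\dots b_p$, $b_j=\prod_{f(i)=j}a_i$, and by zero on words of any other length. Let $\log^\star$ be formed with the convolution product $(\phi\star\psi)(a_1\dots a_n)=\sum_{k=0}^n\phi(a_1\dots a_k)\star\psi(a_{k+1}\dots a_n)$, whose unit is the projection of $T(A)$ onto $A^{\otimes 0}=\mathbb{Q}$. Then for every word $a_1\dots a_n$ over $A$ the partial sums of the series for $\log^\star(\mathrm{Id}_{T(A)})(a_1\dots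 a_n)$ are eventually equal to the value of the right-hand side above on $a_1\dots a_n$. -/

import Mathlib

open scoped TensorProduct

noncomputable section

set_option linter.unusedSectionVars false

namespace QuasiShuffle

section Combinatorics

/-- Surjections from `[n]` onto `[p]` for some `p` (necessarily `p ≤ n`). The sets `[n]`, `[p]` are
`Fin n`, `Fin p`, i.e. the `i`-th element of `[n]` is the element of `Fin n` with value `i - 1`.
For `n = 0` there is exactly one such surjection, the empty one. -/
abbrev Surj (n : ℕ) : Type :=
  Σ p : Fin (n + 1), {f : Fin n → Fin p // Function.Surjective f}

/-- The surjection `pack w` associated with a word `w = w₁ … wₙ` over a linearly ordered alphabet: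
if `b₁ < … < b_p` are the letters occurring in `w`, the letter `b_j` is replaced by `j`
(with values numbered from zero: a letter is sent to the number of smaller letters of `w`). -/
def pack {n : ℕ} {α : Type*} [LinearOrder α] (w : Fin n → α) : Surj n :=
  ⟨⟨(Finset.univ.image w).card, Nat.lt_succ_of_le (by
      simpa using Finset.card_image_le (s := (Finset.univ : Finset (Fin n))) (f := w))⟩,
    ⟨fun i => ⟨((Finset.univ.image w).filter (fun b => b < w i)).card, by
        refine Finset.card_lt_card (t := Finset.univ.image w) ?_
        rw [Finset.ssubset_iff_of_subset (Finset.filter_subset _ _)]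
        exact ⟨w i, by simp, by simp⟩⟩, by
      intro j
      set s := Finset.univ.image w with hs
      have hj : j.1 < s.card := j.2
      have hmem : s.orderEmbOfFin rfl ⟨j.1, hj⟩ ∈ s := Finset.orderEmbOfFin_mem _ _ _
      obtain ⟨i, -, hi⟩ := Finset.mem_image.mp hmem
      refine ⟨i, Fin.ext ?_⟩
      change (s.filter (fun b => b < w i)).card = j.1
      have hfil : s.filter (fun b => b < w i)
          = (Finset.univ.filter (fun k : Fin s.card => k < ⟨j.1, hj⟩)).map
              (s.orderEmbOfFin rfl).toEmbedding := by
        ext b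
        simp only [Finset.mem_filter, Finset.mem_map, Finset.mem_univ, true_and]
        constructor
        · rintro ⟨hb, hlt⟩
          have : b ∈ Set.range (s.orderEmbOfFin rfl) := by
            rw [Finset.range_orderEmbOfFin]; exact hb
          obtain ⟨k, rfl⟩ := this
          rw [hi] at hlt
          exact ⟨k, (s.orderEmbOfFin rfl).lt_iff_lt.mp hlt, rfl⟩
        · rintro ⟨k, hk, rfl⟩
          refine ⟨Finset.orderEmbOfFin_mem _ _ _, ?_⟩
          rw [hi]
          exact (s.orderEmbOfFin rfl).lt_iff_lt.mpr hk
      rw [hfil, Finset.card_map, Finset.filter_gt_eq_Iio]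
      simp⟩⟩

/-- The first `i` letters of `f`, packed. -/
def packTake {n : ℕ} (f : Surj n) (i : ℕ) (hi : i ≤ n) : Surj i :=
  pack (fun j : Fin i => f.2.1 ⟨j, by omega⟩)

/-- The last `n - i` letters of `f`, packed. -/
def packDrop {n : ℕ} (f : Surj n) (i : ℕ) : Surj (n - i) :=
  pack (fun j : Fin (n - i) => f.2.1 ⟨i + j, by omega⟩)

/-- The completion `∏_{n,p} WQSym_{n,p}` of the linear span of all surjections over `ℚ`: an element is
the family of its coefficients on the surjections (each `WQSym_n` has a finite basis). -/
abbrev WQSymHat : Type := (n : ℕ) → Surj n → ℚ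

/-- The quasi-shuffle (convolution) product. On basis elements, `f ⋆ g` is the sum of all
surjections `h` of `[n + m]` whose restriction to the first `n` elements packs to `f` and whose
restriction to the last `m` elements packs to `g`. -/
def WQSymHat.mul (x y : WQSymHat) : WQSymHat := fun n h =>
  ∑ i : Fin (n + 1), x i (packTake h i (by omega)) * y (n - i) (packDrop h i)

/-- The unit: the empty surjection of degree `0`. -/
def WQSymHat.one : WQSymHat := fun n _ => if n = 0 then 1 else 0

/-- Powers for the quasi-shuffle product. -/
def WQSymHat.pow (x : WQSymHat) : ℕ → WQSymHat
  | 0 => WQSymHat.one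
  | k + 1 => WQSymHat.mul x (WQSymHat.pow x k)

/-- `y = log x` for the quasi-shuffle product, i.e. `y = ∑_{k ≥ 1} (-1)^(k-1)/k (x - 1)^k`, where the
series converges formally: in every degree its partial sums are eventually equal to `y`. -/
def WQSymHat.IsLog (x y : WQSymHat) : Prop :=
  ∀ n : ℕ, ∀ᶠ N : ℕ in Filter.atTop,
    (∑ k ∈ Finset.Icc 1 N, ((-1 : ℚ) ^ (k - 1) / k) • WQSymHat.pow (x - WQSymHat.one) k) n = y n

/-- The identity map of `[n]`. -/
def idSurj (n : ℕ) : Surj n := ⟨⟨n, Nat.lt_succ_self n⟩, ⟨id, Function.surjective_id⟩⟩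

/-- `Id`: the sum of the identity maps of all the sets `[n]`, `n ≥ 0`. -/
def WQSymHat.Id : WQSymHat := fun n => Pi.single (idSurj n) 1

/-- The descent set `{i ∈ [n] : i < n, f(i) > f(i+1)}`, with positions numbered from `1`. -/
def Des {n : ℕ} (f : Surj n) : Finset ℕ :=
  (Finset.Icc 1 n).filter
    (fun i => ∃ h : 1 ≤ i ∧ i < n, f.2.1 ⟨i, h.2⟩ < f.2.1 ⟨i - 1, by omega⟩)

/-- The conjugate surjection `f̃ (i) = f (n + 1 - i)`. -/
def conj {n : ℕ} (f : Surj n) : Surj n :=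
  ⟨f.1, ⟨fun i => f.2.1 i.rev, f.2.2.comp Fin.rev_surjective⟩⟩

/-- For `I = (i₁, …, i_l)`, the set `{i_l, i_l + i_{l-1}, …, i_l + ⋯ + i₁}`. -/
def revPartialSums {n : ℕ} (I : Composition n) : Finset ℕ :=
  (Finset.Icc 1 I.length).image (fun j => (I.blocks.reverse.take j).sum)

/-- The element
`∑_{n ≥ 1} 1/n ∑_{I ⊨ n} (-1)^(l(I)-1) / C(n-1, l(I)-1) ∑_{Des f = [n] - {i_l, …, i_l+⋯+i₁}} f̃`. -/
def explicitLog : WQSymHat := fun n =>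
  if n = 0 then 0 else
    (1 / (n : ℚ)) • ∑ I : Composition n,
      ((-1 : ℚ) ^ (I.length - 1) / ((n - 1).choose (I.length - 1) : ℚ)) •
        ∑ f : Surj n with Des f = Finset.Icc 1 n \ revPartialSums I, Pi.single (conj f) (1 : ℚ)

end Combinatorics

section Tensors

variable {A : Type*} [NonUnitalCommRing A] [Module ℚ A] [IsScalarTower ℚ A A]
  [SMulCommClass ℚ A A]

/-- The action of a surjection `f : [n] → [p]` on words:
`f (a₁ … aₙ) = b₁ … b_p`, where `b_j` is the product in `A` of the `a_i` with `f i = j`.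
As `A` need not have a unit, the (non-empty) product is computed in the unitization of `A`. -/
def Surj.act {n : ℕ} (f : Surj n) (a : Fin n → A) : TensorAlgebra ℚ A :=
  TensorAlgebra.tprod ℚ A f.1 (fun j => (∏ i with f.2.1 i = j, (a i : Unitization ℚ A)).snd)

/-- The action of an element of the completion of `WQSym` on words. -/
def WQSymHat.act (x : WQSymHat) {n : ℕ} (a : Fin n → A) : TensorAlgebra ℚ A :=
  ∑ f : Surj n, x n f • f.act a

/-- Induction on words, letter by letter from the left. -/
theorem left_induction {C : TensorAlgebra ℚ A → Prop} (one : C 1)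
    (cons : ∀ b v, C v → C (TensorAlgebra.ι ℚ b * v))
    (add : ∀ u v, C u → C v → C (u + v)) (smul : ∀ (r : ℚ) v, C v → C (r • v))
    (x : TensorAlgebra ℚ A) : C x := by
  suffices h : ∀ v, C v → C (x * v) by simpa using h 1 one
  induction x using TensorAlgebra.induction with
  | algebraMap r => intro v hv; rw [← Algebra.smul_def]; exact smul r v hv
  | ι b => exact cons b
  | mul x y hx hy => intro v hv; rw [mul_assoc]; exact hx _ (hy _ hv)
  | add x y hx hy => intro v hv; rw [add_mul]; exact add _ _ (hx _ hv) (hy _ hv)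

/-- One step of the recursion for `half`, see `half_cons`. -/
def halfStep (a : A) (φ : TensorAlgebra ℚ A →ₗ[ℚ] TensorAlgebra ℚ A) :
    A →ₗ[ℚ] Module.End ℚ (TensorAlgebra ℚ A × TensorAlgebra ℚ A) :=
  LinearMap.mk₂ ℚ (fun b s => (TensorAlgebra.ι ℚ b * s.1,
      TensorAlgebra.ι ℚ a * φ (TensorAlgebra.ι ℚ b * s.1) + TensorAlgebra.ι ℚ b * s.2
        + TensorAlgebra.ι ℚ (a * b) * φ s.1))
    (by intro b b' s; ext <;> simp [mul_add, add_mul]; abel)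
    (by intro r b s; ext <;> simp [mul_smul_comm, smul_add])
    (by intro b s s'; ext <;> simp [mul_add]; abel)
    (by intro r b s; ext <;> simp [smul_add])

/-- The map `v ↦ (a × u) ⋆ v`, given `φ = (u ⋆ ·)`. -/
def half (a : A) (φ : TensorAlgebra ℚ A →ₗ[ℚ] TensorAlgebra ℚ A) :
    TensorAlgebra ℚ A →ₗ[ℚ] TensorAlgebra ℚ A :=
  LinearMap.snd ℚ _ _ ∘ₗ
    LinearMap.applyₗ (1, TensorAlgebra.ι ℚ a * φ 1) ∘ₗ
      (TensorAlgebra.lift ℚ (halfStep a φ)).toLinearMap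

theorem half_one (a : A) (φ : TensorAlgebra ℚ A →ₗ[ℚ] TensorAlgebra ℚ A) :
    half a φ 1 = TensorAlgebra.ι ℚ a * φ 1 := by
  simp [half]

theorem halfStep_fst (a : A) (φ : TensorAlgebra ℚ A →ₗ[ℚ] TensorAlgebra ℚ A)
    (v : TensorAlgebra ℚ A) (w : TensorAlgebra ℚ A) :
    (TensorAlgebra.lift ℚ (halfStep a φ) v (1, w)).1 = v := by
  induction v using left_induction with
  | one => simp
  | cons b v h =>
    rw [map_mul, Module.End.mul_apply, TensorAlgebra.lift_ι_apply]
    exact congrArg (TensorAlgebra.ι ℚ b * ·) h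
  | add u v hu hv => simp [hu, hv]
  | smul r v hv => simp [hv]

theorem half_cons (a : A) (φ : TensorAlgebra ℚ A →ₗ[ℚ] TensorAlgebra ℚ A) (b : A)
    (v : TensorAlgebra ℚ A) :
    half a φ (TensorAlgebra.ι ℚ b * v) =
      TensorAlgebra.ι ℚ a * φ (TensorAlgebra.ι ℚ b * v) + TensorAlgebra.ι ℚ b * half a φ v
        + TensorAlgebra.ι ℚ (a * b) * φ v := by
  have h := halfStep_fst a φ v (TensorAlgebra.ι ℚ a * φ 1)
  simp only [half, LinearMap.comp_apply, AlgHom.toLinearMap_apply, map_mul,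
    LinearMap.applyₗ_apply_apply, Module.End.mul_apply, TensorAlgebra.lift_ι_apply,
    LinearMap.snd_apply]
  simp only [halfStep, LinearMap.mk₂_apply] at h ⊢
  rw [h]

/-- `half` as a bilinear map. -/
def halfLin : A →ₗ[ℚ] Module.End ℚ (TensorAlgebra ℚ A →ₗ[ℚ] TensorAlgebra ℚ A) :=
  LinearMap.mk₂ ℚ half
    (by
      intro a a' φ; ext v
      induction v using left_induction with
      | one => simp [half_one, add_mul]
      | cons b v h => simp only [half_cons, LinearMap.add_apply, h, map_add, add_mul, mul_add]; abel
      | add u v hu hv => simp only [map_add, hu, hv]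
      | smul r v hv => simp only [map_smul, hv])
    (by
      intro r a φ; ext v
      induction v using left_induction with
      | one => simp [half_one]
      | cons b v h =>
        simp only [half_cons, LinearMap.smul_apply, h, map_smul, smul_mul_assoc, mul_smul_comm,
          smul_add]
      | add u v hu hv => simp only [map_add, hu, hv]
      | smul r v hv => simp only [map_smul, hv])
    (by
      intro a φ φ'; ext v
      induction v using left_induction with
      | one => simp [half_one, mul_add]
      | cons b v h => simp only [half_cons, LinearMap.add_apply, h, mul_add]; abel
      | add u v hu hv => simp only [map_add, hu, hv]
      | smul r v hv => simp only [map_smul, hv])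
    (by
      intro r a φ; ext v
      induction v using left_induction with
      | one => simp [half_one]
      | cons b v h =>
        simp only [half_cons, LinearMap.smul_apply, h, mul_smul_comm, smul_add]
      | add u v hu hv => simp only [map_add, hu, hv]
      | smul r v hv => simp only [map_smul, hv])

/-- The quasi-shuffle product on `T(A)`. It is the bilinear product with unit `1` (the empty word)
such that
`a u ⋆ b v = a (u ⋆ b v) + b (a u ⋆ v) + (a · b) (u ⋆ v)` for letters `a, b` and words `u, v`;
see `qsh_one_left`, `qsh_one_right` and `qsh_cons_cons`. -/
def qsh : TensorAlgebra ℚ A →ₗ[ℚ] TensorAlgebra ℚ A →ₗ[ℚ] TensorAlgebra ℚ A :=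
  LinearMap.applyₗ LinearMap.id ∘ₗ (TensorAlgebra.lift ℚ (halfLin (A := A))).toLinearMap

theorem qsh_one_left (v : TensorAlgebra ℚ A) : qsh 1 v = v := by
  simp [qsh]

theorem qsh_cons (a : A) (u : TensorAlgebra ℚ A) :
    qsh (TensorAlgebra.ι ℚ a * u) = half a (qsh u) := by
  simp [qsh, halfLin]

theorem qsh_one_right (u : TensorAlgebra ℚ A) : qsh u 1 = u := by
  induction u using left_induction with
  | one => simp [qsh_one_left]
  | cons b v h => rw [qsh_cons, half_one, h]
  | add u v hu hv => simp [hu, hv]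
  | smul r v hv => simp [hv]

theorem qsh_cons_cons (a b : A) (u v : TensorAlgebra ℚ A) :
    qsh (TensorAlgebra.ι ℚ a * u) (TensorAlgebra.ι ℚ b * v) =
      TensorAlgebra.ι ℚ a * qsh u (TensorAlgebra.ι ℚ b * v)
        + TensorAlgebra.ι ℚ b * qsh (TensorAlgebra.ι ℚ a * u) v
        + TensorAlgebra.ι ℚ (a * b) * qsh u v := by
  rw [qsh_cons, half_cons]

/-- One step of the recursion for `deconcat`, see `deconcat_cons`. -/
def deconcatStep : A →ₗ[ℚ]
    Module.End ℚ (TensorAlgebra ℚ A × (TensorAlgebra ℚ A ⊗[ℚ] TensorAlgebra ℚ A)) :=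
  LinearMap.mk₂ ℚ (fun b s => (TensorAlgebra.ι ℚ b * s.1,
      1 ⊗ₜ[ℚ] (TensorAlgebra.ι ℚ b * s.1) + (TensorAlgebra.ι ℚ b ⊗ₜ[ℚ] 1) * s.2))
    (by
      intro b b' s
      refine Prod.ext ?_ ?_
      · simp [add_mul]
      · simp [add_mul, TensorProduct.add_tmul, TensorProduct.tmul_add]; abel)
    (by
      intro r b s
      refine Prod.ext ?_ ?_
      · simp
      · simp [← TensorProduct.smul_tmul', smul_add])
    (by
      intro b s s'
      refine Prod.ext ?_ ?_
      · simp [mul_add]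
      · simp [mul_add, TensorProduct.tmul_add]; abel)
    (by
      intro r b s
      refine Prod.ext ?_ ?_
      · simp
      · simp [smul_add])

/-- The deconcatenation coproduct `Δ(a₁ … aₙ) = ∑_{0 ≤ k ≤ n} a₁ … a_k ⊗ a_{k+1} … aₙ` on `T(A)`,
i.e. `Δ(1) = 1 ⊗ 1` and `Δ(b v) = 1 ⊗ b v + (b ⊗ 1) Δ(v)`, where `b ⊗ 1` acts by concatenation;
see `deconcat_one` and `deconcat_cons`. -/
def deconcat : TensorAlgebra ℚ A →ₗ[ℚ] TensorAlgebra ℚ A ⊗[ℚ] TensorAlgebra ℚ A :=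
  LinearMap.snd ℚ _ _ ∘ₗ LinearMap.applyₗ (1, 1 ⊗ₜ[ℚ] 1) ∘ₗ
    (TensorAlgebra.lift ℚ (deconcatStep (A := A))).toLinearMap

theorem deconcat_one : deconcat (1 : TensorAlgebra ℚ A) = 1 ⊗ₜ[ℚ] 1 := by
  simp [deconcat]

theorem deconcatStep_fst (v : TensorAlgebra ℚ A) (w : TensorAlgebra ℚ A ⊗[ℚ] TensorAlgebra ℚ A) :
    (TensorAlgebra.lift ℚ (deconcatStep (A := A)) v (1, w)).1 = v := by
  induction v using left_induction with
  | one => simp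
  | cons b v h =>
    rw [map_mul, Module.End.mul_apply, TensorAlgebra.lift_ι_apply]
    exact congrArg (TensorAlgebra.ι ℚ b * ·) h
  | add u v hu hv => simp [hu, hv]
  | smul r v hv => simp [hv]

theorem deconcat_cons (b : A) (v : TensorAlgebra ℚ A) :
    deconcat (TensorAlgebra.ι ℚ b * v) =
      1 ⊗ₜ[ℚ] (TensorAlgebra.ι ℚ b * v) + (TensorAlgebra.ι ℚ b ⊗ₜ[ℚ] 1) * deconcat v := by
  have h := deconcatStep_fst v (1 ⊗ₜ[ℚ] 1)
  simp only [deconcat, LinearMap.comp_apply, AlgHom.toLinearMap_apply, map_mul,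
    LinearMap.applyₗ_apply_apply, Module.End.mul_apply, TensorAlgebra.lift_ι_apply,
    LinearMap.snd_apply]
  simp only [deconcatStep, LinearMap.mk₂_apply] at h ⊢
  rw [h]

/-- The quasi-shuffle convolution product of linear endomorphisms of `T(A)`:
`(φ ⋆ ψ)(a₁ … aₙ) = ∑_k φ(a₁ … a_k) ⋆ ψ(a_{k+1} … aₙ)`. -/
def conv (φ ψ : Module.End ℚ (TensorAlgebra ℚ A)) : Module.End ℚ (TensorAlgebra ℚ A) :=
  TensorProduct.lift qsh ∘ₗ TensorProduct.map φ ψ ∘ₗ deconcat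

/-- The unit of the convolution product: the projection of `T(A)` onto `T₀(A) = ℚ`. -/
def convOne : Module.End ℚ (TensorAlgebra ℚ A) :=
  Algebra.linearMap ℚ (TensorAlgebra ℚ A) ∘ₗ
    (TensorAlgebra.algebraMapInv (R := ℚ) (M := A)).toLinearMap

/-- Convolution powers. -/
def convPow (φ : Module.End ℚ (TensorAlgebra ℚ A)) : ℕ → Module.End ℚ (TensorAlgebra ℚ A)
  | 0 => convOne
  | k + 1 => conv φ (convPow φ k)

/-- The partial sum `∑_{1 ≤ k ≤ N} (-1)^(k-1)/k (φ - 1)^k` of the logarithm of `φ` for the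
quasi-shuffle convolution product. -/
def convLogPartial (φ : Module.End ℚ (TensorAlgebra ℚ A)) (N : ℕ) :
    Module.End ℚ (TensorAlgebra ℚ A) :=
  ∑ k ∈ Finset.Icc 1 N, ((-1 : ℚ) ^ (k - 1) / k) • convPow (φ - convOne) k

end Tensors

end QuasiShuffle

end

/-! The coefficient of `h` in `(Id - 1)^k` counts the ways to cut the word `h(1)…h(n)` into `k`
non-empty strictly increasing factors. If the word has `D` weak descents, each of them forces a cut
and the other `k - 1 - D` cuts are free among the remaining `n - 1 - D` places, so the count is
`C(n-1-D, k-1-D)` (`pow_Id_sub_one_apply`). The alternating sum over `k` with weights `1/k` is a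
Beta integral, equal to `(-1)^D / (n C(n-1, D))` (`sum_log_blockCount`).

In the explicit formula, reversing a word turns its strict ascents into descents, so the conjugate
of `h` has `n - 1 - D` descents. The complement of this descent set in `[n]` has `D + 1` elements,
among them `n`, and is therefore cut out by exactly one composition `I`, of length `D + 1`. Hence a
single `I` contributes to `h`, with the same coefficient (`explicitLog_apply`).

The statement on `T(A)` follows because the action on words carries the product of surjections to
convolution (`act_mul`, `convPow_tprod`). This rests on `qsh_act_act`: a surjection is the ordered
list of its fibres, and the quasi-shuffles of two such lists on complementary sets of positions are
exactly the ordered partitions whose traces on these sets are the two given lists. -/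

noncomputable section

namespace QuasiShuffle

/-! ### Quasi-shuffles of lists of finite sets -/

section Lists

set_option linter.unusedSectionVars false

variable {X : Type*} [DecidableEq X]

/-- The quasi-shuffles of two lists of finite sets. -/
def quasiShuffles : List (Finset X) → List (Finset X) → Finset (List (Finset X))
  | [], Q => {Q}
  | P, [] => {P}
  | B :: P, C :: Q =>
    (quasiShuffles P (C :: Q)).image (List.cons B) ∪
      (quasiShuffles (B :: P) Q).image (List.cons C) ∪
        (quasiShuffles P Q).image (List.cons (B ∪ C))
  termination_by P Q => P.length + Q.length

theorem quasiShuffles_nil_left (Q : List (Finset X)) : quasiShuffles [] Q = {Q} := by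
  rw [quasiShuffles]

theorem quasiShuffles_nil_right (P : List (Finset X)) : quasiShuffles P [] = {P} := by
  cases P <;> simp [quasiShuffles]

theorem quasiShuffles_cons_cons (B C : Finset X) (P Q : List (Finset X)) :
    quasiShuffles (B :: P) (C :: Q) =
      (quasiShuffles P (C :: Q)).image (List.cons B) ∪
        (quasiShuffles (B :: P) Q).image (List.cons C) ∪
          (quasiShuffles P Q).image (List.cons (B ∪ C)) := by
  rw [quasiShuffles]

/-- The traces on `{x | p x}` of the members of a list of finite sets, without the empty ones. -/
def restrict (p : X → Prop) [DecidablePred p] (R : List (Finset X)) : List (Finset X) :=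
  (R.map (Finset.filter p)).filter (fun B => B.Nonempty)

variable (p : X → Prop) [DecidablePred p]

theorem restrict_cons (B : Finset X) (R : List (Finset X)) :
    restrict p (B :: R) =
      if (B.filter p).Nonempty then B.filter p :: restrict p R else restrict p R := by
  by_cases h : (B.filter p).Nonempty <;> simp [restrict, h]

theorem restrict_eq_nil {R : List (Finset X)} :
    restrict p R = [] ↔ ∀ B ∈ R, ∀ x ∈ B, ¬ p x := by
  simp [restrict, Finset.filter_eq_empty_iff]

theorem restrict_eq_self {R : List (Finset X)} (hne : ∀ B ∈ R, B.Nonempty)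
    (h : ∀ B ∈ R, ∀ x ∈ B, p x) : restrict p R = R := by
  induction R with
  | nil => simp [restrict]
  | cons B R ih =>
    rw [restrict_cons, Finset.filter_true_of_mem (h B (by simp)), if_pos (hne B (by simp)),
      ih (fun C hC => hne C (by simp [hC])) (fun C hC => h C (by simp [hC]))]

/-- The recursive and the global description of quasi-shuffles agree: the head of `R` comes from
`P`, from `Q`, or from merging both heads, according to which of its traces on `p` and `¬ p` are
non-empty. -/
theorem mem_quasiShuffles {P Q R : List (Finset X)} (hP : ∀ B ∈ P, B.Nonempty ∧ ∀ x ∈ B, p x)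
    (hQ : ∀ B ∈ Q, B.Nonempty ∧ ∀ x ∈ B, ¬ p x) :
    R ∈ quasiShuffles P Q ↔
      (∀ B ∈ R, B.Nonempty) ∧ restrict p R = P ∧ restrict (fun x => ¬ p x) R = Q := by
  induction R generalizing P Q with
  | nil =>
    rcases P with _ | ⟨B, P⟩ <;> rcases Q with _ | ⟨C, Q⟩ <;>
      simp [quasiShuffles_nil_left, quasiShuffles_nil_right, quasiShuffles_cons_cons, restrict]
  | cons D R ih =>
    rcases P with _ | ⟨B, P⟩
    · rw [quasiShuffles_nil_left, Finset.mem_singleton, restrict_eq_nil]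
      constructor
      · rintro rfl
        exact ⟨fun B hB => (hQ B hB).1, fun B hB => (hQ B hB).2,
          restrict_eq_self _ (fun B hB => (hQ B hB).1) fun B hB => (hQ B hB).2⟩
      · rintro ⟨h1, h2, h3⟩
        rw [← h3, restrict_eq_self _ h1 h2]
    rcases Q with _ | ⟨C, Q⟩
    · rw [quasiShuffles_nil_right, Finset.mem_singleton, restrict_eq_nil]
      constructor
      · intro h
        rw [h]
        exact ⟨fun B hB => (hP B hB).1,
          restrict_eq_self _ (fun B hB => (hP B hB).1) fun B hB => (hP B hB).2,
          fun B hB => by simpa using (hP B hB).2⟩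
      · rintro ⟨h1, h2, h3⟩
        rw [← h2, restrict_eq_self _ h1 (by simpa using h3)]
    have hB := hP B (by simp)
    have hC := hQ C (by simp)
    have hP' : ∀ B ∈ P, B.Nonempty ∧ ∀ x ∈ B, p x := fun E hE => hP E (by simp [hE])
    have hQ' : ∀ B ∈ Q, B.Nonempty ∧ ∀ x ∈ B, ¬ p x := fun E hE => hQ E (by simp [hE])
    have fB1 : B.filter p = B := Finset.filter_true_of_mem hB.2
    have fB2 : B.filter (fun x => ¬ p x) = ∅ :=
      Finset.filter_false_of_mem (by simpa using hB.2)
    have fC1 : C.filter p = ∅ := Finset.filter_false_of_mem hC.2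
    have fC2 : C.filter (fun x => ¬ p x) = C := Finset.filter_true_of_mem hC.2
    simp only [quasiShuffles_cons_cons, Finset.mem_union, Finset.mem_image, List.cons.injEq,
      exists_eq_right_right]
    rw [ih hP' hQ, ih hP hQ', ih hP' hQ']
    rw [restrict_cons, restrict_cons]
    constructor
    · rintro ((⟨⟨h1, h2, h3⟩, rfl⟩ | ⟨⟨h1, h2, h3⟩, rfl⟩) | ⟨⟨h1, h2, h3⟩, rfl⟩)
      · simp [fB1, fB2, h2, h3, hB.1]; exact h1
      · simp [fC1, fC2, h2, h3, hC.1]; exact h1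
      · simp [Finset.filter_union, fB1, fB2, fC1, fC2, h2, h3, hB.1, hC.1]; exact h1
    · rintro ⟨h1, h2, h3⟩
      have hD : D.Nonempty := h1 D (by simp)
      have hR : ∀ B ∈ R, B.Nonempty := fun E hE => h1 E (by simp [hE])
      have hU := Finset.filter_union_filter_not_eq p D
      by_cases c1 : (D.filter p).Nonempty <;> by_cases c2 : (D.filter (fun x => ¬ p x)).Nonempty
      · rw [if_pos c1, List.cons.injEq] at h2
        rw [if_pos c2, List.cons.injEq] at h3
        exact Or.inr ⟨⟨hR, h2.2, h3.2⟩, by rw [← h2.1, ← h3.1, hU]⟩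
      · rw [if_pos c1, List.cons.injEq] at h2
        rw [if_neg c2] at h3
        rw [Finset.not_nonempty_iff_eq_empty] at c2
        rw [c2, Finset.union_empty] at hU
        exact Or.inl (Or.inl ⟨⟨hR, h2.2, h3⟩, by rw [← h2.1, hU]⟩)
      · rw [if_neg c1] at h2
        rw [if_pos c2, List.cons.injEq] at h3
        rw [Finset.not_nonempty_iff_eq_empty] at c1
        rw [c1, Finset.empty_union] at hU
        exact Or.inl (Or.inr ⟨⟨hR, h2, h3.2⟩, by rw [← h3.1, hU]⟩)
      · rw [Finset.not_nonempty_iff_eq_empty] at c1 c2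
        rw [c1, c2] at hU
        simp [← hU] at hD

theorem exists_mem_of_mem_restrict {x : X} {R : List (Finset X)}
    (h : ∃ B ∈ restrict p R, x ∈ B) : ∃ B ∈ R, x ∈ B := by
  obtain ⟨B, hB, hx⟩ := h
  simp only [restrict, List.mem_filter, List.mem_map] at hB
  obtain ⟨⟨C, hC, rfl⟩, -⟩ := hB
  exact ⟨C, hC, (Finset.mem_filter.mp hx).1⟩

/-- Disjointness is phrased one point at a time so that it can be checked on `p` and on its
complement separately, each from the corresponding trace. -/
theorem pairwise_of_pairwise_restrict {x : X} (hx : p x) {R : List (Finset X)}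
    (h : (restrict p R).Pairwise (fun B C => x ∈ B → x ∉ C)) :
    R.Pairwise (fun B C => x ∈ B → x ∉ C) := by
  rw [restrict, List.pairwise_filter, List.pairwise_map] at h
  refine h.imp fun {B C} h hB hC => ?_
  refine h ?_ ?_ (by simp [hB, hx]) (by simp [hC, hx])
  · simpa using ⟨x, by simp [hB, hx]⟩
  · simpa using ⟨x, by simp [hC, hx]⟩

end Lists

/-! ### Surjections as lists of fibres -/

/-- The list of the fibres of a surjection. -/
def fibers {n : ℕ} (h : Surj n) : List (Finset (Fin n)) :=
  (List.finRange h.1).map (fun j => Finset.univ.filter (fun x => h.2.1 x = j))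

theorem fibers_nonempty {n : ℕ} (h : Surj n) : ∀ B ∈ fibers h, B.Nonempty := by
  intro B hB
  obtain ⟨j, -, rfl⟩ := List.mem_map.mp hB
  obtain ⟨x, hx⟩ := h.2.2 j
  exact ⟨x, by simp [hx]⟩

theorem exists_mem_fibers {n : ℕ} (h : Surj n) (x : Fin n) : ∃ B ∈ fibers h, x ∈ B :=
  ⟨_, List.mem_map.mpr ⟨h.2.1 x, List.mem_finRange _, rfl⟩, by simp⟩

theorem fibers_pairwise {n : ℕ} (h : Surj n) (x : Fin n) :
    (fibers h).Pairwise (fun B C => x ∈ B → x ∉ C) := by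
  rw [fibers, List.pairwise_map]
  refine (List.nodup_finRange _).imp fun {j k} hjk hj hk => hjk ?_
  simp only [Finset.mem_filter, Finset.mem_univ, true_and] at hj hk
  rw [← hj, hk]

theorem fibers_injective {n : ℕ} : Function.Injective (fibers (n := n)) := by
  rintro ⟨p, f, hf⟩ ⟨q, g, hg⟩ h
  have hpq : p = q := by
    have := congrArg List.length h
    simpa [fibers, Fin.ext_iff] using this
  subst hpq
  have : f = g := by
    funext x
    simp only [fibers, List.map_inj_left] at h
    have := h (f x) (List.mem_finRange _)
    have hx : x ∈ Finset.univ.filter (fun y => f y = f x) := by simp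
    rw [this] at hx
    exact Eq.symm (by simpa using hx)
  subst this
  rfl

/-- With `fibers_injective`, this identifies surjections with ordered set partitions: each point is
sent to the index of the only block containing it. -/
theorem exists_fibers_eq {n : ℕ} {R : List (Finset (Fin n))} (hne : ∀ B ∈ R, B.Nonempty)
    (hex : ∀ x, ∃ B ∈ R, x ∈ B) (hpw : ∀ x, R.Pairwise (fun B C => x ∈ B → x ∉ C)) :
    ∃ h : Surj n, fibers h = R := by
  have key : ∀ x, ∃ j : Fin R.length, ∀ k : Fin R.length, x ∈ R.get k ↔ k = j := by
    intro x
    obtain ⟨B, hB, hx⟩ := hex x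
    obtain ⟨j, rfl⟩ := List.get_of_mem hB
    refine ⟨j, fun k => ⟨fun hk => ?_, fun h => h ▸ hx⟩⟩
    have h := List.pairwise_iff_get.mp (hpw x)
    rcases lt_trichotomy k j with hlt | heq | hgt
    · exact absurd hx (h _ _ hlt hk)
    · exact heq
    · exact absurd hk (h _ _ hgt hx)
  choose f hf using key
  have hsurj : Function.Surjective f := by
    intro j
    obtain ⟨x, hx⟩ := hne (R.get j) (List.get_mem _ _)
    exact ⟨x, ((hf x j).mp hx).symm⟩
  have hle : R.length ≤ n := by simpa using Fintype.card_le_of_surjective f hsurj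
  refine ⟨⟨⟨R.length, Nat.lt_succ_of_le hle⟩, f, hsurj⟩, ?_⟩
  have : ∀ j, Finset.univ.filter (fun x => f x = j) = R.get j := by
    intro j
    ext x
    simp [hf x j, eq_comm, -List.get_eq_getElem]
  simp only [fibers, this]
  rw [← List.ofFn_eq_map, List.ofFn_get]

/-- The increasing enumeration of the letters of `w` undoes the packing. All later facts about
`pack` use only this factorization and surjectivity. -/
theorem exists_strictMono_pack {n : ℕ} {α : Type*} [LinearOrder α] (w : Fin n → α) :
    ∃ E : Fin (pack w).1 → α, StrictMono E ∧ ∀ i, E ((pack w).2.1 i) = w i := by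
  set s := Finset.univ.image w with hs
  refine ⟨s.orderEmbOfFin rfl, (s.orderEmbOfFin rfl).strictMono, fun i => ?_⟩
  obtain ⟨k, hk⟩ : w i ∈ Set.range (s.orderEmbOfFin rfl) := by
    rw [Finset.range_orderEmbOfFin]; simp [hs]
  rw [← hk]
  congr 1
  refine Fin.ext ?_
  change (s.filter (fun b => b < w i)).card = k
  have : s.filter (fun b => b < w i)
      = (Finset.univ.filter (fun j : Fin s.card => j < k)).map
          (s.orderEmbOfFin rfl).toEmbedding := by
    rw [← hk]
    ext b
    simp only [Finset.mem_filter, Finset.mem_map, Finset.mem_univ, true_and]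
    constructor
    · rintro ⟨hb, hlt⟩
      obtain ⟨j, rfl⟩ : b ∈ Set.range (s.orderEmbOfFin rfl) := by
        rw [Finset.range_orderEmbOfFin]; exact hb
      exact ⟨j, (s.orderEmbOfFin rfl).lt_iff_lt.mp hlt, rfl⟩
    · rintro ⟨j, hj, rfl⟩
      exact ⟨Finset.orderEmbOfFin_mem _ _ _, (s.orderEmbOfFin rfl).lt_iff_lt.mpr hj⟩
  rw [this, Finset.card_map, Finset.filter_gt_eq_Iio]
  simp

theorem finRange_filter_eq_map {p r : ℕ} (E : Fin p → Fin r) (hE : StrictMono E)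
    (q : Fin r → Prop) [DecidablePred q] (hq : ∀ j, q j ↔ j ∈ Set.range E) :
    (List.finRange r).filter (fun j => q j) = (List.finRange p).map E := by
  refine List.Perm.eq_of_pairwise (le := (· < ·)) (fun a b _ _ h1 h2 => absurd h1 h2.asymm)
    ((List.pairwise_lt_finRange r).filter _) ?_ ?_
  · rw [List.pairwise_map]
    exact (List.pairwise_lt_finRange p).imp fun h => hE h
  · rw [List.perm_ext_iff_of_nodup ((List.nodup_finRange r).filter _)
      ((List.nodup_finRange p).map hE.injective)]
    intro j
    simp [hq]

/-- Packing a subword is the same as intersecting the fibres with its positions and discarding the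
empty ones: the surviving indices are the letters of the subword, in increasing order. -/
theorem restrict_fibers {n m : ℕ} (h : Surj n) (e : Fin m ↪ Fin n) (p : Fin n → Prop)
    [DecidablePred p] (hp : ∀ x, p x ↔ x ∈ Set.range e) :
    restrict p (fibers h) =
      (fibers (pack (fun i => h.2.1 (e i)))).map (Finset.map e) := by
  obtain ⟨E, hE, hw⟩ := exists_strictMono_pack (fun i => h.2.1 (e i))
  have hsurj := (pack (fun i => h.2.1 (e i))).2.2
  have hfil : ∀ j, (Finset.univ.filter (fun x => h.2.1 x = j)).filter p
      = (Finset.univ.filter (fun y => h.2.1 (e y) = j)).map e := by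
    intro j
    ext x
    simp only [Finset.mem_filter, Finset.mem_univ, true_and, Finset.mem_map, hp, Set.mem_range]
    constructor
    · rintro ⟨h1, y, rfl⟩; exact ⟨y, h1, rfl⟩
    · rintro ⟨y, h1, rfl⟩; exact ⟨h1, y, rfl⟩
  rw [restrict, fibers, List.map_map, List.filter_map]
  have hcomp : (Finset.filter p ∘ fun j => Finset.univ.filter (fun x => h.2.1 x = j))
      = fun j => (Finset.univ.filter (fun y => h.2.1 (e y) = j)).map e := funext hfil
  rw [hcomp]
  have := finRange_filter_eq_map E hE
    (fun j => ((Finset.univ.filter (fun y => h.2.1 (e y) = j)).map e).Nonempty) (by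
      intro j
      simp only [Finset.map_nonempty, Finset.filter_nonempty_iff, Finset.mem_univ, true_and,
        Set.mem_range]
      constructor
      · rintro ⟨y, rfl⟩; exact ⟨_, hw y⟩
      · rintro ⟨k, rfl⟩
        obtain ⟨y, rfl⟩ := hsurj k
        exact ⟨y, (hw y).symm⟩)
  simp only [Function.comp_def]
  rw [this, fibers, List.map_map, List.map_map]
  refine List.map_congr_left fun k _ => ?_
  simp only [Function.comp_apply]
  congr 1
  ext y
  simp only [Finset.mem_filter, Finset.mem_univ, true_and]
  rw [← hw y, hE.injective.eq_iff]

/-! ### The quasi-shuffle product of the actions of two surjections -/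

section Tensors

variable {A : Type*} [NonUnitalCommRing A] [Module ℚ A] [IsScalarTower ℚ A A]
  [SMulCommClass ℚ A A]

/-- The product in `A` of the letters with indices in a non-empty finite set. -/
def letter {X : Type*} (a : X → A) (B : Finset X) : A := (∏ i ∈ B, (a i : Unitization ℚ A)).snd

/-- The word whose letters are the products over the members of a list of finite sets. -/
def blockWord {X : Type*} (a : X → A) (R : List (Finset X)) : TensorAlgebra ℚ A :=
  (R.map (fun B => TensorAlgebra.ι ℚ (letter a B))).prod

/-- A non-empty product of elements of `A` has scalar part zero, so `.snd` loses nothing. The empty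
product `1` would be lost. -/
theorem inr_letter {X : Type*} (a : X → A) {B : Finset X} (hB : B.Nonempty) :
    ((letter a B : A) : Unitization ℚ A) = ∏ i ∈ B, (a i : Unitization ℚ A) := by
  refine Unitization.ext ?_ (by simp [letter])
  have : (∏ i ∈ B, (a i : Unitization ℚ A)).fst = ∏ i ∈ B, (a i : Unitization ℚ A).fst :=
    map_prod (Unitization.fstHom ℚ A) _ _
  rw [this]
  obtain ⟨i, hi⟩ := hB
  rw [Finset.prod_eq_zero hi (by simp)]
  simp

theorem letter_union {X : Type*} [DecidableEq X] (a : X → A) {B C : Finset X} (hB : B.Nonempty)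
    (hC : C.Nonempty) (h : Disjoint B C) : letter a (B ∪ C) = letter a B * letter a C := by
  apply Unitization.inr_injective (R := ℚ)
  rw [inr_letter a (hB.mono Finset.subset_union_left), Unitization.inr_mul, inr_letter a hB,
    inr_letter a hC, Finset.prod_union h]

theorem blockWord_cons {X : Type*} (a : X → A) (B : Finset X) (R : List (Finset X)) :
    blockWord a (B :: R) = TensorAlgebra.ι ℚ (letter a B) * blockWord a R := by
  simp [blockWord]

theorem blockWord_nil {X : Type*} (a : X → A) : blockWord a [] = 1 := by
  simp [blockWord]

theorem sum_blockWord_image_cons {X : Type*} [DecidableEq X] (a : X → A) (B : Finset X)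
    (S : Finset (List (Finset X))) :
    ∑ R ∈ S.image (List.cons B), blockWord a R
      = TensorAlgebra.ι ℚ (letter a B) * ∑ R ∈ S, blockWord a R := by
  rw [Finset.sum_image (by simp), Finset.mul_sum]
  simp [blockWord_cons]

theorem disjoint_image_cons {X : Type*} [DecidableEq X] {B C : Finset X} (h : B ≠ C)
    (S T : Finset (List (Finset X))) :
    Disjoint (S.image (List.cons B)) (T.image (List.cons C)) := by
  rw [Finset.disjoint_left]
  rintro R hR hR'
  obtain ⟨_, -, rfl⟩ := Finset.mem_image.mp hR
  obtain ⟨_, -, h'⟩ := Finset.mem_image.mp hR'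
  exact h (List.cons.inj h').1.symm

/-- Both sides obey the same recursion. Disjointness makes `B`, `C` and `B ∪ C` distinct, so the
three branches do not overlap and the multiplicity-free finset counts every term of the product. -/
theorem qsh_blockWord {X : Type*} [DecidableEq X] (a : X → A) {P Q : List (Finset X)}
    (hP : ∀ B ∈ P, B.Nonempty) (hQ : ∀ C ∈ Q, C.Nonempty) (h : ∀ B ∈ P, ∀ C ∈ Q, Disjoint B C) :
    qsh (blockWord a P) (blockWord a Q) = ∑ R ∈ quasiShuffles P Q, blockWord a R := by
  induction P generalizing Q with
  | nil => simp [quasiShuffles_nil_left, blockWord_nil, qsh_one_left]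
  | cons B P ihP =>
    induction Q with
    | nil => simp [quasiShuffles_nil_right, blockWord_nil, qsh_one_right]
    | cons C Q ihQ =>
      have hB := hP B (by simp)
      have hC := hQ C (by simp)
      have hP' : ∀ B ∈ P, B.Nonempty := fun E hE => hP E (by simp [hE])
      have hQ' : ∀ B ∈ Q, B.Nonempty := fun E hE => hQ E (by simp [hE])
      have hBC : Disjoint B C := h B (by simp) C (by simp)
      have n1 : B ≠ C := hBC.ne hB.ne_empty
      have n2 : B ≠ B ∪ C := fun e => hC.ne_empty
        (disjoint_self.mp (hBC.mono_left (e ▸ Finset.subset_union_right)))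
      have n3 : C ≠ B ∪ C := fun e => hB.ne_empty
        (disjoint_self.mp (hBC.mono_right (e ▸ Finset.subset_union_left)))
      rw [quasiShuffles_cons_cons, Finset.sum_union, Finset.sum_union (disjoint_image_cons n1 _ _),
        sum_blockWord_image_cons, sum_blockWord_image_cons, sum_blockWord_image_cons,
        ← ihP hP' hQ (fun E hE F hF => h E (by simp [hE]) F hF),
        ← ihP hP' hQ' (fun E hE F hF => h E (by simp [hE]) F (by simp [hF])),
        ← ihQ hQ' (fun E hE F hF => h E hE F (by simp [hF])), blockWord_cons, blockWord_cons,
        qsh_cons_cons, letter_union a hB hC hBC]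
      exact Finset.disjoint_union_left.mpr
        ⟨disjoint_image_cons n2 _ _, disjoint_image_cons n3 _ _⟩

theorem act_eq_blockWord {n : ℕ} (h : Surj n) (a : Fin n → A) :
    h.act a = blockWord a (fibers h) := by
  rw [Surj.act, TensorAlgebra.tprod_apply, blockWord, fibers, List.map_map, List.ofFn_eq_map]
  rfl

theorem blockWord_map {X Y : Type*} (e : X ↪ Y) (a : Y → A) (R : List (Finset X)) :
    blockWord a (R.map (Finset.map e)) = blockWord (a ∘ e) R := by
  simp [blockWord, letter, Function.comp_def]

theorem qsh_act_act {n m k : ℕ} (e : Fin m ↪ Fin n) (e' : Fin k ↪ Fin n)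
    (he : ∀ x, x ∈ Set.range e' ↔ x ∉ Set.range e) (f : Surj m) (g : Surj k) (a : Fin n → A) :
    qsh (f.act (a ∘ e)) (g.act (a ∘ e')) =
      ∑ h : Surj n with pack (fun i => h.2.1 (e i)) = f ∧ pack (fun i => h.2.1 (e' i)) = g,
        h.act a := by
  classical
  set p : Fin n → Prop := fun x => x ∈ Set.range e with hp
  set P := (fibers f).map (Finset.map e) with hPdef
  set Q := (fibers g).map (Finset.map e') with hQdef
  have hP : ∀ B ∈ P, B.Nonempty ∧ ∀ x ∈ B, p x := by
    intro B hB
    obtain ⟨C, hC, rfl⟩ := List.mem_map.mp hB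
    refine ⟨(fibers_nonempty f C hC).map, fun x hx => ?_⟩
    obtain ⟨y, -, rfl⟩ := Finset.mem_map.mp hx
    exact ⟨y, rfl⟩
  have hQ : ∀ B ∈ Q, B.Nonempty ∧ ∀ x ∈ B, ¬ p x := by
    intro B hB
    obtain ⟨C, hC, rfl⟩ := List.mem_map.mp hB
    refine ⟨(fibers_nonempty g C hC).map, fun x hx => ?_⟩
    obtain ⟨y, -, rfl⟩ := Finset.mem_map.mp hx
    exact (he _).mp ⟨y, rfl⟩
  have hmem : ∀ h : Surj n, fibers h ∈ quasiShuffles P Q ↔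
      pack (fun i => h.2.1 (e i)) = f ∧ pack (fun i => h.2.1 (e' i)) = g := by
    intro h
    rw [mem_quasiShuffles p hP hQ, restrict_fibers h e p (fun _ => Iff.rfl),
      restrict_fibers h e' (fun x => ¬ p x) (fun x => (he x).symm), hPdef, hQdef,
      (List.map_injective_iff.mpr (Finset.map_injective e)).eq_iff,
      (List.map_injective_iff.mpr (Finset.map_injective e')).eq_iff, fibers_injective.eq_iff,
      fibers_injective.eq_iff]
    exact and_iff_right (fibers_nonempty h)
  rw [act_eq_blockWord, act_eq_blockWord, ← blockWord_map, ← blockWord_map, ← hPdef, ← hQdef,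
    qsh_blockWord a (fun B hB => (hP B hB).1) (fun B hB => (hQ B hB).1)
      (fun B hB C hC => Finset.disjoint_left.mpr fun x hx hx' => (hQ C hC).2 x hx' ((hP B hB).2 x hx))]
  symm
  refine Finset.sum_bij (fun h _ => fibers h) ?_ ?_ ?_ ?_
  · intro h hh
    exact (hmem h).mpr (by simpa using hh)
  · intro h _ h' _ hh
    exact fibers_injective hh
  · intro R hR
    obtain ⟨h1, h2, h3⟩ := (mem_quasiShuffles p hP hQ).mp hR
    -- Each point lies on exactly one side, where the trace of `R` is a transported list of fibres;
    -- so `R` is an ordered partition and comes from a surjection.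
    have hcov : ∀ x, (∃ B ∈ R, x ∈ B) ∧ R.Pairwise (fun B C => x ∈ B → x ∉ C) := by
      intro x
      by_cases hx : p x
      · obtain ⟨y, rfl⟩ := hx
        obtain ⟨B, hB, hy⟩ := exists_mem_fibers f y
        refine ⟨exists_mem_of_mem_restrict p ?_, pairwise_of_pairwise_restrict p ⟨y, rfl⟩ ?_⟩
        · rw [h2]
          exact ⟨_, List.mem_map.mpr ⟨B, hB, rfl⟩, by simpa using hy⟩
        · rw [h2, hPdef, List.pairwise_map]
          simpa using fibers_pairwise f y
      · obtain ⟨y, rfl⟩ := (he x).mpr hx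
        obtain ⟨B, hB, hy⟩ := exists_mem_fibers g y
        refine ⟨exists_mem_of_mem_restrict (fun x => ¬ p x) ?_,
          pairwise_of_pairwise_restrict (fun x => ¬ p x) hx ?_⟩
        · rw [h3]
          exact ⟨_, List.mem_map.mpr ⟨B, hB, rfl⟩, by simpa using hy⟩
        · rw [h3, hQdef, List.pairwise_map]
          simpa using fibers_pairwise g y
    obtain ⟨h, rfl⟩ := exists_fibers_eq h1 (fun x => (hcov x).1) (fun x => (hcov x).2)
    exact ⟨h, by simpa using (hmem h).mp hR, rfl⟩
  · intro h _
    exact act_eq_blockWord h a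

end Tensors

/-! ### Packing -/

theorem pack_lt_pack {n : ℕ} {α : Type*} [LinearOrder α] (w : Fin n → α) (i j : Fin n) :
    (pack w).2.1 i < (pack w).2.1 j ↔ w i < w j := by
  obtain ⟨E, hE, hw⟩ := exists_strictMono_pack w
  rw [← hw i, ← hw j, hE.lt_iff_lt]

theorem eq_idSurj_iff {n : ℕ} (f : Surj n) : f = idSurj n ↔ StrictMono f.2.1 := by
  refine ⟨fun h => h ▸ strictMono_id, fun h => ?_⟩
  obtain ⟨⟨p, hp⟩, f, hf⟩ := f
  have h' : StrictMono f := h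
  obtain rfl : p = n := by
    simpa using (Fintype.card_of_bijective ⟨h'.injective, hf⟩).symm
  have : f = id := (h'.range_inj strictMono_id).mp (by rw [hf.range_eq, Set.range_id])
  subst this
  rfl

theorem surj_zero_eq (f : Surj 0) : f = idSurj 0 :=
  (eq_idSurj_iff f).mpr fun i => i.elim0

/-- The values of a surjection of `[n]`, extended by zero. -/
def extend {n : ℕ} (h : Surj n) (j : ℕ) : ℕ := if hj : j < n then h.2.1 ⟨j, hj⟩ else 0

theorem extend_of_lt {n : ℕ} (h : Surj n) {j : ℕ} (hj : j < n) :
    extend h j = h.2.1 ⟨j, hj⟩ := dif_pos hj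

theorem packTake_eq_idSurj {n : ℕ} (h : Surj n) (i : ℕ) (hi : i ≤ n) :
    packTake h i hi = idSurj i ↔ ∀ j, j + 1 < i → extend h j < extend h (j + 1) := by
  rw [eq_idSurj_iff, packTake]
  constructor
  · intro hm j hj
    rw [extend_of_lt h (by omega), extend_of_lt h (by omega)]
    have := hm (a := ⟨j, by omega⟩) (b := ⟨j + 1, hj⟩) (by simp)
    rw [pack_lt_pack] at this
    exact this
  · intro hm
    rcases i with _ | i
    · exact fun i => i.elim0
    · rw [Fin.strictMono_iff_lt_succ]
      intro j
      rw [pack_lt_pack]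
      have := hm j (by omega)
      rwa [extend_of_lt h (by omega), extend_of_lt h (by omega)] at this

/-! ### Compositions into increasing blocks -/

/-- The number of weak descents of the word `w 0, …, w (n - 1)`. -/
def weakDescents (n : ℕ) (w : ℕ → ℕ) : ℕ := ((Finset.range (n - 1)).filter (fun j => w (j + 1) ≤ w j)).card

theorem weakDescents_le (n : ℕ) (w : ℕ → ℕ) : weakDescents n w ≤ n - 1 :=
  (Finset.card_filter_le _ _).trans_eq (Finset.card_range _)

theorem weakDescents_packDrop {n : ℕ} (h : Surj n) (i : ℕ) :
    weakDescents (n - i) (extend (packDrop h i)) = weakDescents (n - i) (fun j => extend h (i + j)) := by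
  unfold weakDescents
  congr 1
  refine Finset.filter_congr fun j hj => ?_
  rw [Finset.mem_range] at hj
  beta_reduce
  rw [extend_of_lt _ (by omega), extend_of_lt _ (by omega), extend_of_lt _ (by omega),
    extend_of_lt _ (by omega), ← not_lt, ← not_lt, not_iff_not]
  exact pack_lt_pack (fun j : Fin (n - i) => h.2.1 ⟨i + j, by omega⟩) ⟨j, by omega⟩ ⟨j + 1, by omega⟩

theorem weakDescents_add_two (n : ℕ) (w : ℕ → ℕ) :
    weakDescents (n + 2) w =
      weakDescents (n + 1) (fun j => w (j + 1)) + if w 1 ≤ w 0 then 1 else 0 := by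
  simp only [weakDescents, Finset.card_filter]
  exact Finset.sum_range_succ' _ _

/-- The number of ways to cut a word of length `n` with `D` weak descents into `k` non-empty
strictly increasing blocks. -/
def blockCount : ℕ → ℕ → ℕ → ℚ
  | 0, k, _ => if k = 0 then 1 else 0
  | n + 1, k, D => if D < k then ((n - D).choose (k - 1 - D) : ℚ) else 0

/-- A weak descent after the first letter makes that letter a block by itself. The guard `D < k` in
`blockCount` is needed because truncated subtraction would otherwise give `1` when there are too few
blocks. -/
theorem blockCount_descent (n k D : ℕ) :
    blockCount (n + 2) (k + 1) (D + 1) = blockCount (n + 1) k D := by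
  have h1 : n + 1 - (D + 1) = n - D := by omega
  have h2 : k + 1 - 1 - (D + 1) = k - 1 - D := by omega
  simp only [blockCount, h1, h2, Nat.add_lt_add_iff_right]

/-- Pascal's rule: after an ascent one may cut or not. -/
theorem blockCount_ascent (n k D : ℕ) (hD : D ≤ n) :
    blockCount (n + 2) (k + 1) D = blockCount (n + 1) k D + blockCount (n + 1) (k + 1) D := by
  simp only [blockCount]
  rcases lt_trichotomy D k with h | h | h
  · have h1 : n + 1 - D = (n - D) + 1 := by omega
    have h2 : k + 1 - 1 - D = (k - 1 - D) + 1 := by omega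
    rw [if_pos (by omega), if_pos h, if_pos (by omega), h1, h2, Nat.choose_succ_succ]
    push_cast
    rfl
  · subst h; simp
  · rw [if_neg (by omega), if_neg (by omega), if_neg (by omega)]; simp

/-- Sorts the cuttings by the length `i + 1` of the first block. Deleting the first letter of the
word gives the induction, the term `i = 0` being the case where that letter is a whole block. -/
theorem sum_blockCount (n k : ℕ) (w : ℕ → ℕ) :
    ∑ i ∈ Finset.range n, (if ∀ j, j < i → w j < w (j + 1) then
        blockCount (n - (i + 1)) k (weakDescents (n - (i + 1)) (fun j => w (i + 1 + j))) else 0)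
      = blockCount n (k + 1) (weakDescents n w) := by
  induction n generalizing w with
  | zero => simp [blockCount]
  | succ n ih =>
    rw [Finset.sum_range_succ']
    have hstep : ∀ i, (∀ j, j < i + 1 → w j < w (j + 1)) ↔
        w 0 < w 1 ∧ ∀ j, j < i → w (j + 1) < w (j + 1 + 1) := by
      intro i
      constructor
      · exact fun h => ⟨h 0 (by omega), fun j hj => h (j + 1) (by omega)⟩
      · rintro ⟨h0, h⟩ (_ | j) hj
        · exact h0
        · exact h j (by omega)
    have hterm : ∀ i, (if ∀ j, j < i + 1 → w j < w (j + 1) then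
        blockCount (n + 1 - (i + 1 + 1)) k
          (weakDescents (n + 1 - (i + 1 + 1)) (fun j => w (i + 1 + 1 + j))) else 0)
        = if w 0 < w 1 then (if ∀ j, j < i → w (j + 1) < w (j + 1 + 1) then
          blockCount (n - (i + 1)) k
            (weakDescents (n - (i + 1)) (fun j => w (i + 1 + j + 1))) else 0) else 0 := by
      intro i
      simp only [hstep, ite_and, Nat.add_sub_add_right, Nat.add_right_comm _ 1]
    simp only [hterm]
    have h0 : ∀ j, w (0 + 1 + j) = w (j + 1) := fun j => by rw [zero_add, add_comm]
    simp only [h0, Nat.not_lt_zero, false_imp_iff, implies_true, if_true, zero_add,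
      Nat.add_sub_cancel]
    rcases n with _ | n
    · simp [blockCount, weakDescents]
      rcases k with _ | k <;> simp
    · rw [weakDescents_add_two]
      have hD := weakDescents_le (n + 1) (fun j => w (j + 1))
      by_cases h : w 0 < w 1
      · simp only [h, if_true, if_neg (not_le.mpr h), add_zero]
        rw [ih (fun j => w (j + 1)), blockCount_ascent _ _ _ (by omega), add_comm]
      · simp only [h, if_false, if_pos (not_lt.mp h), Finset.sum_const_zero, zero_add]
        rw [blockCount_descent]

theorem Id_sub_one_apply {n : ℕ} (f : Surj n) [Decidable (f = idSurj n)] :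
    (WQSymHat.Id - WQSymHat.one) n f = if n = 0 then 0 else if f = idSurj n then 1 else 0 := by
  simp only [Pi.sub_apply, WQSymHat.Id, WQSymHat.one, Pi.single_apply]
  rcases n with _ | n
  · simp [surj_zero_eq f]
  · simp

theorem pow_Id_sub_one_apply (k n : ℕ) (h : Surj n) :
    WQSymHat.pow (WQSymHat.Id - WQSymHat.one) k n h =
      blockCount n k (weakDescents n (extend h)) := by
  induction k generalizing n with
  | zero => rcases n with _ | n <;> simp [WQSymHat.pow, WQSymHat.one, blockCount]
  | succ k ih =>
    classical
    simp only [WQSymHat.pow, WQSymHat.mul, ih, weakDescents_packDrop, Id_sub_one_apply,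
      packTake_eq_idSurj]
    -- The term `i = 0` is split off and vanishes since `Id - 1` is zero in degree `0`; this is what
    -- makes the blocks non-empty.
    rw [Fin.sum_univ_eq_sum_range (fun i => (if i = 0 then (0 : ℚ) else
      if ∀ j, j + 1 < i → extend h j < extend h (j + 1) then 1 else 0) *
        blockCount (n - i) k (weakDescents (n - i) (fun j => extend h (i + j)))) (n + 1),
      Finset.sum_range_succ', ← sum_blockCount]
    simp

/-! ### The coefficients of the logarithm -/

/-- Both sides equal the integral of `t^D (1-t)^m` over `[0,1]`. The induction uses `(1-t)^(m+1) =
(1-t)^m - t (1-t)^m`, that is, Pascal's rule, which is why `D` varies. -/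
theorem sum_alternating_choose_div (m D : ℕ) :
    ∑ j ∈ Finset.range (m + 1), (-1 : ℚ) ^ j * (m.choose j) / (D + 1 + j) =
      1 / ((D + m + 1) * ((D + m).choose D)) := by
  induction m generalizing D with
  | zero => simp
  | succ m ih =>
    have e : ∑ j ∈ Finset.range (m + 1 + 1), (-1 : ℚ) ^ j * ((m + 1).choose j) / (D + 1 + j) =
        ∑ j ∈ Finset.range (m + 1), (-1 : ℚ) ^ j * (m.choose j) / (D + 1 + j) -
        ∑ j ∈ Finset.range (m + 1), (-1 : ℚ) ^ j * (m.choose j) / ((D + 1 : ℕ) + 1 + j) := by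
      have e1 : ∑ j ∈ Finset.range (m + 1), (-1 : ℚ) ^ j * (m.choose j) / (D + 1 + j) =
          ∑ j ∈ Finset.range (m + 1 + 1), (-1 : ℚ) ^ j * (m.choose j) / (D + 1 + j) := by
        rw [Finset.sum_range_succ _ (m + 1)]; simp
      rw [e1, Finset.sum_range_succ', Finset.sum_range_succ' _ (m + 1), add_sub_right_comm,
        ← Finset.sum_sub_distrib]
      congr 1
      · refine Finset.sum_congr rfl fun j _ => ?_
        rw [Nat.choose_succ_succ]
        push_cast
        rw [show (D : ℚ) + 1 + (j + 1) = D + 1 + 1 + j by ring]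
        ring
      · simp
    rw [e, ih, ih]
    have h1 : ((D + 1 + m).choose (D + 1) : ℚ) * (D + 1) = (D + m + 1) * ((D + m).choose D) := by
      have := Nat.add_one_mul_choose_eq (D + m) D
      rw [show D + m + 1 = D + 1 + m by ring] at this
      rw [show (D : ℚ) + m + 1 = ((D + 1 + m : ℕ) : ℚ) by push_cast; ring]
      exact_mod_cast this.symm
    have h2 : ((D + (m + 1)).choose D : ℚ) * (m + 1) = (D + m + 1) * ((D + m).choose D) := by
      have := Nat.choose_mul_succ_eq (D + m) D
      rw [show D + m + 1 - D = m + 1 by omega] at this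
      have h3 : (((D + m).choose D : ℕ) : ℚ) * (D + m + 1) = (D + m + 1).choose D * (m + 1) := by
        exact_mod_cast this
      rw [← add_assoc, ← h3]; ring
    have c0 : ((D + m).choose D : ℚ) ≠ 0 := by
      exact_mod_cast (Nat.choose_pos (by omega)).ne'
    have d1 : (D : ℚ) + 1 ≠ 0 := by positivity
    have d2 : (m : ℚ) + 1 ≠ 0 := by positivity
    have d3 : (D : ℚ) + m + 1 ≠ 0 := by positivity
    have d4 : (D : ℚ) + m + 2 ≠ 0 := by positivity
    rw [← eq_div_iff d1] at h1
    rw [← eq_div_iff d2] at h2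
    push_cast
    rw [h1, h2]
    field_simp
    ring

theorem sum_log_blockCount {n D N : ℕ} (hD : D < n) (hN : n ≤ N) :
    ∑ k ∈ Finset.Icc 1 N, ((-1 : ℚ) ^ (k - 1) / k) * blockCount n k D =
      1 / n * ((-1) ^ D / ((n - 1).choose D)) := by
  obtain ⟨m, rfl⟩ : ∃ m, n = D + m + 1 := ⟨n - D - 1, by omega⟩
  obtain ⟨t, rfl⟩ : ∃ t, N = D + (m + 1) + t := ⟨N - (D + m + 1), by omega⟩
  have hI : Finset.Icc 1 (D + (m + 1) + t) = Finset.Ico (0 + 1) (D + (m + 1) + t + 1) := by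
    ext; simp
  -- Only `D < k ≤ n` contributes: fewer blocks cannot accommodate the forced cuts, and more than
  -- `n` non-empty blocks do not fit.
  rw [hI, ← Finset.sum_Ico_add', ← Finset.range_eq_Ico, Finset.sum_range_add,
    Finset.sum_range_add]
  have z1 : ∀ k ∈ Finset.range D, ((-1 : ℚ) ^ (k + 1 - 1) / (k + 1 : ℕ)) *
      blockCount (D + m + 1) (k + 1) D = 0 := by
    intro k hk
    rw [Finset.mem_range] at hk
    simp [blockCount, show ¬ D < k + 1 by omega]
  have z2 : ∀ k ∈ Finset.range t, ((-1 : ℚ) ^ (D + (m + 1) + k + 1 - 1) / (D + (m + 1) + k + 1 : ℕ)) *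
      blockCount (D + m + 1) (D + (m + 1) + k + 1) D = 0 := by
    intro k _
    have : (D + m - D).choose (D + (m + 1) + k + 1 - 1 - D) = 0 :=
      Nat.choose_eq_zero_of_lt (by omega)
    simp only [blockCount, this]
    simp
  rw [Finset.sum_eq_zero z1, Finset.sum_eq_zero z2, zero_add, add_zero]
  have e : ∀ j, ((-1 : ℚ) ^ (D + j + 1 - 1) / (D + j + 1 : ℕ)) *
      blockCount (D + m + 1) (D + j + 1) D =
        (-1) ^ D * ((-1 : ℚ) ^ j * (m.choose j) / (D + 1 + j)) := by
    intro j
    simp only [blockCount, if_pos (show D < D + j + 1 by omega), Nat.add_sub_cancel_left,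
      Nat.add_sub_cancel, pow_add]
    push_cast
    rw [show (D : ℚ) + j + 1 = D + 1 + j by ring]
    ring
  simp only [e]
  rw [← Finset.mul_sum, sum_alternating_choose_div, Nat.add_sub_cancel]
  push_cast
  rw [one_div, one_div, mul_inv]
  ring

/-! ### Descent classes and compositions -/

theorem conj_conj {n : ℕ} (f : Surj n) : conj (conj f) = f := by
  simp [conj]

theorem mem_Des {n : ℕ} (f : Surj n) (i : ℕ) :
    i ∈ Des f ↔ ∃ h : 1 ≤ i ∧ i < n, f.2.1 ⟨i, h.2⟩ < f.2.1 ⟨i - 1, by omega⟩ := by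
  rw [Des, Finset.mem_filter, and_iff_right_iff_imp]
  rintro ⟨h, -⟩
  exact Finset.mem_Icc.mpr ⟨h.1, h.2.le⟩

/-- Reversal matches descents of the conjugate with strict ascents of `h`, and each of the `n - 1`
adjacent pairs is either a strict ascent or a weak descent. -/
theorem card_Des_conj {n : ℕ} (h : Surj n) :
    (Des (conj h)).card + weakDescents n (extend h) = n - 1 := by
  have hval : ∀ i (hi : i < n), (h.2.1 (⟨i, hi⟩ : Fin n).rev : ℕ) = extend h (n - 1 - i) := by
    intro i hi
    have : (⟨i, hi⟩ : Fin n).rev = ⟨n - 1 - i, by omega⟩ := Fin.ext (by simp [Fin.val_rev]; omega)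
    rw [this, extend_of_lt]
  have : Des (conj h) = ((Finset.range (n - 1)).filter
      (fun j => ¬ extend h (j + 1) ≤ extend h j)).image (fun j => n - 1 - j) := by
    ext i
    simp only [mem_Des, conj, Finset.mem_filter, Finset.mem_image, Finset.mem_range, not_le,
      Fin.lt_def, hval]
    constructor
    · rintro ⟨⟨h1, h2⟩, h3⟩
      refine ⟨n - 1 - i, ⟨by omega, ?_⟩, by omega⟩
      rwa [show n - 1 - (i - 1) = n - 1 - i + 1 by omega] at h3
    · rintro ⟨j, ⟨h1, h2⟩, rfl⟩
      refine ⟨⟨by omega, by omega⟩, ?_⟩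
      rwa [show n - 1 - (n - 1 - j) = j by omega, show n - 1 - (n - 1 - j - 1) = j + 1 by omega]
  rw [this, Finset.card_image_of_injOn, weakDescents, add_comm,
    Finset.card_filter_add_card_filter_not, Finset.card_range]
  intro j hj k hk hjk
  simp only [Finset.coe_filter, Finset.mem_range, Set.mem_ofPred_eq] at hj hk hjk
  omega

theorem mem_boundaries_reverse {n : ℕ} (I : Composition n) (x : Fin (n + 1)) :
    x ∈ I.reverse.boundaries ↔ x = 0 ∨ (x : ℕ) ∈ revPartialSums I := by
  have hl : I.reverse.length = I.length := by simp [Composition.length]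
  have hs : ∀ j, I.reverse.sizeUpTo j = (I.blocks.reverse.take j).sum := fun j => rfl
  simp only [Composition.boundaries, Finset.mem_map, Finset.mem_univ, true_and, revPartialSums,
    Finset.mem_image, Finset.mem_Icc]
  constructor
  · rintro ⟨j, rfl⟩
    rcases Nat.eq_zero_or_pos (j : ℕ) with hj | hj
    · left
      obtain rfl : j = 0 := Fin.ext hj
      exact I.reverse.boundary_zero
    · exact Or.inr ⟨j, ⟨hj, by omega⟩, rfl⟩
  · rintro (rfl | ⟨j, hj, hx⟩)
    · exact ⟨0, I.reverse.boundary_zero⟩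
    · exact ⟨⟨j, by omega⟩, Fin.ext hx⟩

theorem revPartialSums_subset {n : ℕ} (I : Composition n) :
    revPartialSums I ⊆ Finset.Icc 1 n := by
  intro x hx
  obtain ⟨j, hj, rfl⟩ := Finset.mem_image.mp hx
  rw [Finset.mem_Icc] at hj ⊢
  have hl : I.reverse.length = I.length := by simp [Composition.length]
  refine ⟨?_, I.reverse.sizeUpTo_le j⟩
  have h1 := I.reverse.sizeUpTo_strict_mono (i := 0) (by omega)
  have h2 := I.reverse.monotone_sizeUpTo hj.1
  rw [Composition.sizeUpTo_zero] at h1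
  exact lt_of_lt_of_le h1 h2

/-- The set `S` together with `0` is the boundary set of a unique composition, namely the reverse of
`I`. The total sum `n` is always a boundary, whence `hn`. -/
theorem exists_composition_revPartialSums {n : ℕ} (S : Finset ℕ) (hS : S ⊆ Finset.Icc 1 n)
    (hn : n = 0 ∨ n ∈ S) :
    ∃ I₀ : Composition n, I₀.length = S.card ∧ ∀ I, revPartialSums I = S ↔ I = I₀ := by
  set c : CompositionAsSet n :=
    { boundaries := Finset.univ.filter (fun x => x = 0 ∨ (x : ℕ) ∈ S)
      zero_mem := by simp
      getLast_mem := by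
        rcases hn with h | h
        · subst h; simp
        · simp [h] } with hc
  have key : ∀ I, revPartialSums I = S ↔ I = c.toComposition.reverse := by
    intro I
    have h1 : I = c.toComposition.reverse ↔ I.reverse = c.toComposition := by
      rw [← Composition.reverse_inj, Composition.reverse_reverse]
    have h2 : I.reverse = c.toComposition ↔ I.reverse.boundaries = c.boundaries := by
      rw [← (compositionEquiv n).injective.eq_iff, CompositionAsSet.ext_iff]
      simp [compositionEquiv]
    rw [h1, h2, Finset.ext_iff, Finset.ext_iff]
    simp only [mem_boundaries_reverse, hc, Finset.mem_filter, Finset.mem_univ, true_and]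
    have hI := revPartialSums_subset I
    constructor
    · intro h x
      rw [h]
    · intro h x
      by_cases hx : x ∈ Finset.Icc 1 n
      · have hx' := Finset.mem_Icc.mp hx
        have := h ⟨x, by omega⟩
        simpa [Fin.ext_iff, show x ≠ 0 by omega] using this
      · exact ⟨fun h => absurd (hI h) hx, fun h => absurd (hS h) hx⟩
  refine ⟨c.toComposition.reverse, ?_, key⟩
  have hr := (key _).mpr rfl
  have hcard := c.toComposition.card_boundaries_eq_succ_length
  have hl : c.toComposition.reverse.length = c.toComposition.length := by
    simp [Composition.length]
  rw [hl, ← Nat.add_right_cancel_iff (n := 1), ← hcard, c.toComposition_boundaries]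
  have : (c.boundaries.map Fin.valEmbedding) = insert 0 S := by
    ext x
    simp only [hc, Finset.mem_map, Finset.mem_filter, Finset.mem_univ, true_and,
      Fin.valEmbedding_apply, Finset.mem_insert]
    constructor
    · rintro ⟨y, rfl | hy, rfl⟩
      · simp
      · exact Or.inr hy
    · rintro (rfl | hx)
      · exact ⟨0, Or.inl rfl, rfl⟩
      · have := Finset.mem_Icc.mp (hS hx)
        exact ⟨⟨x, by omega⟩, Or.inr hx, rfl⟩
  rw [← Finset.card_map Fin.valEmbedding, this, Finset.card_insert_of_notMem]
  intro h0
  have := Finset.mem_Icc.mp (hS h0)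
  omega

theorem explicitLog_apply {n : ℕ} (hn : n ≠ 0) (h : Surj n) :
    explicitLog n h = 1 / n * ((-1) ^ weakDescents n (extend h) /
      ((n - 1).choose (weakDescents n (extend h)))) := by
  have hsub : Des (conj h) ⊆ Finset.Icc 1 n := Finset.filter_subset _ _
  obtain ⟨I₀, hlen, hI₀⟩ := exists_composition_revPartialSums (Finset.Icc 1 n \ Des (conj h))
    -- Descents are smaller than `n`, so `n` lies in the complement.
    Finset.sdiff_subset (by simp [Des]; omega)
  have hl : I₀.length - 1 = weakDescents n (extend h) := by
    have h1 := card_Des_conj h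
    rw [hlen, Finset.card_sdiff_of_subset hsub, Nat.card_Icc]
    omega
  have hiff : ∀ I : Composition n, Des (conj h) = Finset.Icc 1 n \ revPartialSums I ↔ I = I₀ := by
    intro I
    rw [← hI₀]
    constructor
    · intro e
      rw [e, Finset.sdiff_sdiff_eq_self (revPartialSums_subset I)]
    · intro e
      rw [e, Finset.sdiff_sdiff_eq_self hsub]
  have hinner : ∀ I : Composition n,
      (∑ f : Surj n with Des f = Finset.Icc 1 n \ revPartialSums I,
        (Pi.single (conj f) (1 : ℚ) : Surj n → ℚ)) h = if I = I₀ then 1 else 0 := by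
    intro I
    have hc : ∀ f : Surj n, h = conj f ↔ f = conj h := fun f =>
      ⟨fun e => by rw [e, conj_conj], fun e => by rw [e, conj_conj]⟩
    simp only [Finset.sum_apply, Pi.single_apply, hc, Finset.sum_ite_eq', Finset.mem_filter,
      Finset.mem_univ, true_and, hiff]
  rw [explicitLog, if_neg hn, Pi.smul_apply, Finset.sum_apply]
  simp only [Pi.smul_apply, hinner, smul_eq_mul, mul_ite, mul_one, mul_zero, Finset.sum_ite_eq',
    Finset.mem_univ, if_true, hl]

theorem isLog_Id_explicitLog : WQSymHat.IsLog WQSymHat.Id explicitLog := by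
  intro n
  filter_upwards [Filter.eventually_ge_atTop n] with N hN
  funext h
  simp only [Finset.sum_apply, Pi.smul_apply, smul_eq_mul, pow_Id_sub_one_apply]
  rcases Nat.eq_zero_or_pos n with rfl | hn
  · rw [Finset.sum_eq_zero]
    · simp [explicitLog]
    · intro k hk
      have := (Finset.mem_Icc.mp hk).1
      simp [blockCount, show k ≠ 0 by omega]
  · rw [explicitLog_apply hn.ne', sum_log_blockCount _ hN]
    have := weakDescents_le n (extend h)
    omega

/-! ### The action on words is compatible with the convolution products -/

section Tensors

set_option linter.unusedSectionVars false

variable {A : Type*} [NonUnitalCommRing A] [Module ℚ A] [IsScalarTower ℚ A A]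
  [SMulCommClass ℚ A A]

theorem act_idSurj {n : ℕ} (a : Fin n → A) :
    (idSurj n).act a = TensorAlgebra.tprod ℚ A n a := by
  have : ∀ j : Fin n, (∏ i with id i = j, (a i : Unitization ℚ A)).snd = a j := by
    intro j
    simp [Finset.filter_eq']
  exact congrArg (TensorAlgebra.tprod ℚ A n) (funext this)

theorem deconcat_list_prod (l : List A) :
    deconcat (l.map (TensorAlgebra.ι ℚ)).prod =
      ∑ i ∈ Finset.range (l.length + 1),
        ((l.take i).map (TensorAlgebra.ι ℚ)).prod ⊗ₜ[ℚ] ((l.drop i).map (TensorAlgebra.ι ℚ)).prod := by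
  induction l with
  | nil => simp [deconcat_one]
  | cons b l ih =>
    rw [List.length_cons, Finset.sum_range_succ', List.map_cons, List.prod_cons, deconcat_cons, ih,
      Finset.mul_sum, add_comm]
    simp

theorem conv_list_prod (φ ψ : Module.End ℚ (TensorAlgebra ℚ A)) (l : List A) :
    conv φ ψ (l.map (TensorAlgebra.ι ℚ)).prod =
      ∑ i ∈ Finset.range (l.length + 1), qsh (φ ((l.take i).map (TensorAlgebra.ι ℚ)).prod)
        (ψ ((l.drop i).map (TensorAlgebra.ι ℚ)).prod) := by
  simp [conv, deconcat_list_prod]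

theorem tprod_eq_list_prod {n : ℕ} (a : Fin n → A) :
    TensorAlgebra.tprod ℚ A n a = ((List.ofFn a).map (TensorAlgebra.ι ℚ)).prod := by
  rw [TensorAlgebra.tprod_apply, List.map_ofFn]
  rfl

/-- The first `i` elements of `[n]`. -/
def takeEmb {n : ℕ} (i : Fin (n + 1)) : Fin i ↪ Fin n :=
  ⟨fun j => ⟨j, by omega⟩, fun j k h => by simpa [Fin.ext_iff] using h⟩

/-- The last `n - i` elements of `[n]`. -/
def dropEmb {n : ℕ} (i : Fin (n + 1)) : Fin (n - i) ↪ Fin n :=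
  ⟨fun j => ⟨i + j, by omega⟩, fun j k h => by simpa [Fin.ext_iff] using h⟩

theorem takeEmb_apply {n : ℕ} (i : Fin (n + 1)) (j : Fin i) : takeEmb i j = ⟨j, by omega⟩ := rfl

theorem dropEmb_apply {n : ℕ} (i : Fin (n + 1)) (j : Fin (n - i)) :
    dropEmb i j = ⟨i + j, by omega⟩ := rfl

theorem conv_tprod (φ ψ : Module.End ℚ (TensorAlgebra ℚ A)) {n : ℕ} (a : Fin n → A) :
    conv φ ψ (TensorAlgebra.tprod ℚ A n a) =
      ∑ i : Fin (n + 1), qsh (φ (TensorAlgebra.tprod ℚ A i (a ∘ takeEmb i)))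
        (ψ (TensorAlgebra.tprod ℚ A (n - i) (a ∘ dropEmb i))) := by
  rw [tprod_eq_list_prod, conv_list_prod, List.length_ofFn, ← Fin.sum_univ_eq_sum_range
    (fun i => qsh (φ (((List.ofFn a).take i).map (TensorAlgebra.ι ℚ)).prod)
      (ψ (((List.ofFn a).drop i).map (TensorAlgebra.ι ℚ)).prod))]
  refine Finset.sum_congr rfl fun i _ => ?_
  have h1 : (List.ofFn a).take i = List.ofFn (a ∘ takeEmb i) := by
    refine List.ext_getElem (by simp; omega) fun j hj hj' => ?_
    simp [takeEmb_apply]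
  have h2 : (List.ofFn a).drop i = List.ofFn (a ∘ dropEmb i) := by
    refine List.ext_getElem (by simp) fun j hj hj' => ?_
    simp [dropEmb_apply]
  rw [tprod_eq_list_prod, tprod_eq_list_prod, h1, h2]

/-- After bilinear expansion and exchange of sums, each `h` meets exactly one pair `(f, g)`: its
packed initial and final parts. -/
theorem qsh_wqsym_act (x y : WQSymHat) {n : ℕ} (i : Fin (n + 1)) (a : Fin n → A) :
    qsh (x.act (a ∘ takeEmb i)) (y.act (a ∘ dropEmb i)) =
      ∑ h : Surj n, (x i (packTake h i (by omega)) * y (n - i) (packDrop h i)) • h.act a := by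
  classical
  have hrange : ∀ z, z ∈ Set.range (dropEmb i) ↔ z ∉ Set.range (takeEmb i) := by
    intro z
    simp only [Set.mem_range, dropEmb_apply, takeEmb_apply, Fin.ext_iff, not_exists]
    constructor
    · rintro ⟨j, hj⟩ k; omega
    · intro h
      have h' : (i : ℕ) ≤ z := by
        by_contra hlt
        exact h ⟨z, by omega⟩ rfl
      exact ⟨⟨z - i, by omega⟩, by simp; omega⟩
  have hq := fun f g => qsh_act_act (takeEmb i) (dropEmb i) hrange f g a
  have hterm : ∀ f g (h : Surj n), (if pack (fun j => h.2.1 (takeEmb i j)) = f ∧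
      pack (fun j => h.2.1 (dropEmb i j)) = g then x i f • y (n - i) g • h.act a else 0) =
      if packTake h i (by omega) = f then
        if packDrop h i = g then (x i f * y (n - i) g) • h.act a else 0 else 0 := by
    intro f g h
    rw [← ite_and, smul_smul]
    rfl
  calc qsh (x.act (a ∘ takeEmb i)) (y.act (a ∘ dropEmb i))
      = ∑ f, ∑ g, x i f • y (n - i) g • qsh (f.act (a ∘ takeEmb i)) (g.act (a ∘ dropEmb i)) := by
        simp only [WQSymHat.act, map_sum, LinearMap.sum_apply, map_smul, LinearMap.smul_apply,
          Finset.smul_sum]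
        rw [Finset.sum_comm]
        exact Finset.sum_congr rfl fun _ _ => Finset.sum_congr rfl fun _ _ => smul_comm _ _ _
    _ = ∑ f, ∑ g, ∑ h : Surj n, if packTake h i (by omega) = f then
        if packDrop h i = g then (x i f * y (n - i) g) • h.act a else 0 else 0 := by
        simp only [hq, Finset.sum_filter, Finset.smul_sum, smul_ite, smul_zero, hterm]
    _ = ∑ f, ∑ h : Surj n, ∑ g, if packTake h i (by omega) = f then
        if packDrop h i = g then (x i f * y (n - i) g) • h.act a else 0 else 0 :=
        Finset.sum_congr rfl fun _ _ => Finset.sum_comm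
    _ = ∑ h : Surj n, ∑ f, ∑ g, if packTake h i (by omega) = f then
        if packDrop h i = g then (x i f * y (n - i) g) • h.act a else 0 else 0 := Finset.sum_comm
    _ = _ := by simp

theorem act_mul (x y : WQSymHat) {n : ℕ} (a : Fin n → A) :
    (WQSymHat.mul x y).act a =
      ∑ i : Fin (n + 1), qsh (x.act (a ∘ takeEmb i)) (y.act (a ∘ dropEmb i)) := by
  simp only [qsh_wqsym_act]
  rw [Finset.sum_comm]
  simp only [WQSymHat.act, WQSymHat.mul, Finset.sum_smul]

theorem act_sub (x y : WQSymHat) {n : ℕ} (a : Fin n → A) :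
    (x - y).act a = x.act a - y.act a := by
  simp [WQSymHat.act, sub_smul]

theorem act_Id {n : ℕ} (a : Fin n → A) : WQSymHat.Id.act a = TensorAlgebra.tprod ℚ A n a := by
  simp [WQSymHat.act, WQSymHat.Id, Pi.single_apply, ite_smul, act_idSurj]

theorem act_one {n : ℕ} (a : Fin n → A) :
    WQSymHat.one.act a = convOne (TensorAlgebra.tprod ℚ A n a) := by
  rcases n with _ | n
  · have : (Finset.univ : Finset (Surj 0)) = {idSurj 0} := by
      ext f; simpa using surj_zero_eq f
    simp [WQSymHat.act, WQSymHat.one, convOne, this, act_idSurj, TensorAlgebra.tprod_apply]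
  · have : TensorAlgebra.algebraMapInv (TensorAlgebra.ι ℚ (a 0)) = 0 := by
      simp [TensorAlgebra.algebraMapInv]
    simp [WQSymHat.act, WQSymHat.one, convOne, TensorAlgebra.tprod_apply, this]

theorem convPow_tprod (k : ℕ) {n : ℕ} (a : Fin n → A) :
    convPow (LinearMap.id - convOne) k (TensorAlgebra.tprod ℚ A n a) =
      (WQSymHat.pow (WQSymHat.Id - WQSymHat.one) k).act a := by
  induction k generalizing n with
  | zero => exact (act_one a).symm
  | succ k ih =>
    simp only [convPow, WQSymHat.pow, conv_tprod, act_mul, ih, act_sub, act_Id, act_one,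
      LinearMap.sub_apply, LinearMap.id_apply]

theorem convLogPartial_tprod (N : ℕ) {n : ℕ} (a : Fin n → A) :
    convLogPartial LinearMap.id N (TensorAlgebra.tprod ℚ A n a) =
      (∑ k ∈ Finset.Icc 1 N, ((-1 : ℚ) ^ (k - 1) / k) •
        WQSymHat.pow (WQSymHat.Id - WQSymHat.one) k).act a := by
  simp only [convLogPartial, LinearMap.sum_apply, LinearMap.smul_apply, convPow_tprod,
    WQSymHat.act, Finset.sum_apply, Pi.smul_apply, Finset.sum_smul, Finset.smul_sum, smul_assoc]
  rw [Finset.sum_comm]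

end Tensors

end QuasiShuffle

end

theorem mainTheorem10 :
    QuasiShuffle.WQSymHat.IsLog QuasiShuffle.WQSymHat.Id QuasiShuffle.explicitLog ∧
    ∀ (A : Type*) [NonUnitalCommRing A] [Module ℚ A] [IsScalarTower ℚ A A] [SMulCommClass ℚ A A]
      (n : ℕ) (a : Fin n → A), ∀ᶠ N : ℕ in Filter.atTop,
        QuasiShuffle.convLogPartial LinearMap.id N (TensorAlgebra.tprod ℚ A n a) =
          QuasiShuffle.WQSymHat.act QuasiShuffle.explicitLog a := by
  refine ⟨QuasiShuffle.isLog_Id_explicitLog, fun A _ _ _ _ n a => ?_⟩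
  -- On words of length `n` only the degree `n` component acts, so the partial sums stabilize as
  -- soon as they do in that degree.
  filter_upwards [QuasiShuffle.isLog_Id_explicitLog n] with N hN
  rw [QuasiShuffle.convLogPartial_tprod, QuasiShuffle.WQSymHat.act, hN, QuasiShuffle.WQSymHat.act]
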